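/- Let $n\ge 1$, let $\rho_1,\dots,\rho_n>0$, and let $F$ be a probability distribution function with $F(0)=0$. Consider the size-$n$ on-off system with recovery rates $\rho_1,\dots,\rho_n$ and input interval distribution function $F$: let $\tau_1,\tau_2,\dots$ be i.i.d. with distribution function $F$, and call $T_m=\tau_1+\dots+\tau_m$ ($m\ge 0$) the input times. The right-continuous $\{0,1\}$-valued processes $X_1(t),\dots,X_n(t)$, $t\ge0$, with left limits, all start at $0$ at time $0$. The lengths of the successive intervals during which $X_j=0$ are exponentially distributed with mean $1/\rho_j$, and all these lengths, for all $j$, and the $\tau_m$ are independent. A node $j$ switches from $1$ to $0$ at a time $t>0$ (we say that node $j$ receives a signal at time $t$) if and only if $t$ is an input time and $X_j,X_{j+1},\dots,X_n$ are all equal to $1$ just before $t$. Let $1\le i\le n$. Let $S^i_0=0$, and let $S^i_k$, $k\ge1$, be the successive times at which node $i$ receives a signal. Almost surely these are all well defined and finite, and the differences $S^i_{k+1}-S^i_k$, $k\ge 0$, all have the same distribution function $F^{(i)}$, called the interreception time distribution function of node $i$. Then $F^{(i)}$ is invariant under permutations of the sequence $\rho_i,\rho_{i+1},\dots,\rho_n$: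 if $\sigma$ is a permutation of $\{1,\dots,n\}$ with $\sigma(j)=j$ for all $j<i$, then the on-off systems with the same input interval distribution function $F$ and with recovery rates $\rho_1,\dots,\rho_n$ and $\rho_{\sigma(1)},\dots,\rho_{\sigma(n)}$, respectively, have the same interreception time distribution function $F^{(i)}$ of node $i$. -/

import Mathlib

open MeasureTheory ProbabilityTheory Filter Topology

noncomputable section

namespace OnOff

/-- The path `x` (with `true` = on = `1`, `false` = off = `0`) is on just before time `t`. -/
def OnBefore (x : ℝ → Bool) (t : ℝ) : Prop := ∀ᶠ s in 𝓝[<] t, x s = true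

/-- The path `x` is off just before time `t`. -/
def OffBefore (x : ℝ → Bool) (t : ℝ) : Prop := ∀ᶠ s in 𝓝[<] t, x s = false

/-- A node with path `x` receives a signal at time `t > 0`: it switches from on to off. -/
def Receives (x : ℝ → Bool) (t : ℝ) : Prop := 0 < t ∧ OnBefore x t ∧ x t = false

/-- A node with path `x` recovers at time `t > 0`: it switches from off to on. -/
def Recovers (x : ℝ → Bool) (t : ℝ) : Prop := 0 < t ∧ OffBefore x t ∧ x t = true

/-- The path `x : [0, ∞) → {0, 1}` is right-continuous with left limits
(its values at negative times are irrelevant). -/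
def IsCadlag (x : ℝ → Bool) : Prop :=
  (∀ t, 0 ≤ t → ∀ᶠ s in 𝓝[>] t, x s = x t) ∧ (∀ t, 0 < t → OnBefore x t ∨ OffBefore x t)

/-- `receptionTime x k` is the time of the `k`-th reception of a signal;
the zeroth one is, by convention, time `0`. -/
def receptionTime (x : ℝ → Bool) : ℕ → ℝ
  | 0 => 0
  | k + 1 => sInf {t | receptionTime x k < t ∧ Receives x t}

/-- The first recovery after the `k`-th reception. -/
def recoveryTime (x : ℝ → Bool) (k : ℕ) : ℝ :=
  sInf {t | receptionTime x k < t ∧ Recovers x t}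

/-- The length of the `k`-th interval (`k = 0, 1, …`) during which the node is off. -/
def offDuration (x : ℝ → Bool) (k : ℕ) : ℝ := recoveryTime x k - receptionTime x k

/-- The time between the `k`-th and the `(k+1)`-st reception (`k = 0, 1, …`). -/
def interreceptionTime (x : ℝ → Bool) (k : ℕ) : ℝ :=
  receptionTime x (k + 1) - receptionTime x k

/-- The `m`-th input time `T_m`, the sum of the first `m` input intervals; `T_0 = 0`. -/
def inputTime (τ : ℕ → ℝ) (m : ℕ) : ℝ := ∑ j ∈ Finset.range m, τ j

/-- The deterministic rules for the paths `x i` of the nodes, given the input intervals `τ`: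
all nodes start off, the paths are càdlàg, and node `i` receives a signal at time `t > 0` exactly
when `t` is an input time and all nodes from `i` to the rightmost one are on just before `t`. -/
structure IsOnOffPath {n : ℕ} (τ : ℕ → ℝ) (x : Fin n → ℝ → Bool) : Prop where
  start : ∀ i, x i 0 = false
  cadlag : ∀ i, IsCadlag (x i)
  signal : ∀ i t, 0 < t →
    (Receives (x i) t ↔ (∃ m, t = inputTime τ m) ∧ ∀ j, i ≤ j → OnBefore (x j) t)

/-- `(τ, X)` is a size `n` on-off system on the probability space `(Ω, P)` with recovery rates `ρ`
and input interval distribution `ν`. The nodes are indexed by `Fin n`, from left to right.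
The input intervals have law `ν`, the lengths of the off-intervals of node `i` are exponential with
rate `ρ i`, all these variables are jointly independent, and the rules hold almost surely. -/
structure IsOnOffSystem {n : ℕ} {Ω : Type*} [MeasurableSpace Ω] (P : Measure Ω)
    (ν : Measure ℝ) (ρ : Fin n → ℝ) (τ : ℕ → Ω → ℝ) (X : Fin n → ℝ → Ω → Bool) : Prop where
  law_input : ∀ k, HasLaw (τ k) ν P
  law_off : ∀ i k, HasLaw (fun ω => offDuration (fun t => X i t ω) k) (expMeasure (ρ i)) P
  indep : iIndepFun (Sum.elim τ
    (fun (p : Fin n × ℕ) (ω : Ω) => offDuration (fun t => X p.1 t ω) p.2)) P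
  path : ∀ᵐ ω ∂P, IsOnOffPath (fun k => τ k ω) (fun i t => X i t ω)

end OnOff

end

noncomputable section

namespace OnOff

/-! ### Paths -/

/-! The rightmost node needs only itself to be on: after each reception it stays off for an
exponential time and then receives the first input strictly later. At a reception everything starts
afresh, since the remaining input intervals and off-durations are independent of the past, so its
reception times form a renewal process. If `ν` is the input interval law and `r` the rate of the
node, `thin (expMeasure r) ν` is its interreception law (`map_receptions`). The other nodes see
these receptions as their inputs and form an on-off system with one node fewer
(`IsOnOffSystem.castSucc`). By induction the law for node `i` comes from `ν` by thinning
successively with the rates of the nodes `n, …, i`.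

It remains to see that thinnings commute. Put φ(z) = E exp(zτ) for Re z ≤ 0. If R is the
off-duration and T_m ≤ R < T_{m+1}, the reception is at T_{m+1}; given the inputs, this has
probability exp(-r T_m) - exp(-r T_{m+1}). Summing a geometric series over m, the transform ψ of the
thinned law satisfies 1 - ψ(z) = (1 - φ(z)) / (1 - φ(z - r)) (`one_sub_complexMGF_thin`). Thinning
with b and then a gives (1 - φ(z))(1 - φ(z-a-b)) / ((1 - φ(z-a))(1 - φ(z-b))), symmetric in a and b
(`thin_comm`). Adjacent transpositions generate all permutations. -/

lemma IsCadlag.exists_first_change {x : ℝ → Bool} (hx : IsCadlag x) {a t : ℝ} {b : Bool}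
    (ha : 0 ≤ a) (hat : a ≤ t) (hxa : x a = b) (hxt : x t ≠ b) :
    ∃ u, a < u ∧ u ≤ t ∧ (∀ s, a ≤ s → s < u → x s = b) ∧ x u ≠ b := by
  set S := {s | a ≤ s ∧ x s ≠ b} with hS
  have hbdd : BddBelow S := ⟨a, fun s hs => hs.1⟩
  have htS : t ∈ S := ⟨hat, hxt⟩
  have hau : a ≤ sInf S := le_csInf ⟨t, htS⟩ fun s hs => hs.1
  have hbefore : ∀ s, a ≤ s → s < sInf S → x s = b := fun s has hs => by
    by_contra h
    exact absurd (csInf_le hbdd ⟨has, h⟩) (not_le.2 hs)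
  have hxu : x (sInf S) ≠ b := fun h => by
    have hright := hx.1 _ (ha.trans hau)
    rw [h] at hright
    obtain ⟨v, hv, hvs⟩ := mem_nhdsGT_iff_exists_Ioo_subset.1 hright
    obtain ⟨s, hs, hsv⟩ := exists_lt_of_csInf_lt ⟨t, htS⟩ (show sInf S < v from hv)
    have hle := csInf_le hbdd hs
    rcases hle.eq_or_lt with he | hlt
    · exact hs.2 (he ▸ h)
    · exact hs.2 (hvs ⟨hlt, hsv⟩)
  refine ⟨sInf S, lt_of_le_of_ne hau fun h => hxu (h ▸ hxa), csInf_le hbdd htS, hbefore, hxu⟩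

lemma eventually_nhdsLT_of_forall {x : ℝ → Bool} {a u : ℝ} {b : Bool} (hau : a < u)
    (h : ∀ s, a ≤ s → s < u → x s = b) : ∀ᶠ s in 𝓝[<] u, x s = b := by
  filter_upwards [Ioo_mem_nhdsLT hau] with s hs using h s hs.1.le hs.2

lemma not_onBefore_of_offBefore {x : ℝ → Bool} {t : ℝ} (h : OffBefore x t) : ¬ OnBefore x t := by
  intro h'
  obtain ⟨s, hs, hs'⟩ := (h.and h').exists
  simp [hs] at hs'

/-- If the infimum of the recoveries after `a` exceeds `a`, then it is the first such recovery. -/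
lemma IsCadlag.recovers_sInf {x : ℝ → Bool} (hx : IsCadlag x) {a : ℝ} (ha : 0 ≤ a)
    (h : a < sInf {t | a < t ∧ Recovers x t}) :
    IsLeast {t | a < t ∧ Recovers x t} (sInf {t | a < t ∧ Recovers x t}) := by
  set S := {t | a < t ∧ Recovers x t} with hS
  -- The infimum of the empty set is 0 by default, which cannot exceed `a ≥ 0`.
  have hne : S.Nonempty := by
    by_contra hne
    rw [Set.not_nonempty_iff_eq_empty] at hne
    rw [hne, Real.sInf_empty] at h
    exact absurd h (not_lt.2 ha)
  have hbdd : BddBelow S := ⟨a, fun s hs => hs.1.le⟩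
  refine ⟨?_, fun s hs => csInf_le hbdd hs⟩
  -- Otherwise recoveries accumulate at the infimum from the right, where the path is constant by
  -- right-continuity.
  by_contra hnot
  obtain ⟨v, hv, hvs⟩ := mem_nhdsGT_iff_exists_Ioo_subset.1 (hx.1 _ (ha.trans h.le))
  obtain ⟨s, hs, hsv⟩ := exists_lt_of_csInf_lt hne (show sInf S < v from hv)
  have hlt : sInf S < s := lt_of_le_of_ne (csInf_le hbdd hs) fun he => hnot (he ▸ hs)
  have hconst : ∀ r, sInf S < r → r ≤ s → x r = x (sInf S) :=
    fun r hr hr' => hvs ⟨hr, hr'.trans_lt hsv⟩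
  have hon : OnBefore x s := by
    filter_upwards [Ioo_mem_nhdsLT hlt] with r hr
    rw [hconst r hr.1 hr.2.le, ← hconst s hlt le_rfl, hs.2.2.2]
  exact not_onBefore_of_offBefore hs.2.2.1 hon

lemma receptionTime_nonneg (x : ℝ → Bool) (k : ℕ) : 0 ≤ receptionTime x k := by
  cases k with
  | zero => exact le_rfl
  | succ k => exact Real.sInf_nonneg fun t ht => ht.2.1.le

/-- A positive off-duration certifies that a recovery exists and that the infimum defining it is
attained. -/
lemma IsCadlag.recovery_spec {x : ℝ → Bool} (hx : IsCadlag x) {k : ℕ}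
    (hoff : 0 < offDuration x k) (hk : x (receptionTime x k) = false) :
    (∀ s, receptionTime x k ≤ s → s < recoveryTime x k → x s = false) ∧
      x (recoveryTime x k) = true := by
  have hlt : receptionTime x k < recoveryTime x k := by
    unfold offDuration at hoff; linarith
  have hleast := hx.recovers_sInf (receptionTime_nonneg x k) hlt
  refine ⟨fun s hs hsr => ?_, hleast.1.2.2.2⟩
  by_contra hne
  obtain ⟨u, hu, hus, hub, hxu⟩ :=
    hx.exists_first_change (receptionTime_nonneg x k) hs hk hne
  have : u ∈ {t | receptionTime x k < t ∧ Recovers x t} :=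
    ⟨hu, (receptionTime_nonneg x k).trans_lt hu, eventually_nhdsLT_of_forall hu hub,
      by simpa using hxu⟩
  exact absurd (hleast.2 this) (not_le.2 (hus.trans_lt hsr))

/-- The index of the first input time after time `r`. -/
def passIdx (τ : ℕ → ℝ) (r : ℝ) : ℕ := sInf {m | r < inputTime τ m}

lemma inputTime_shift (τ : ℕ → ℝ) (m k : ℕ) :
    inputTime (fun j => τ (j + m)) k = inputTime τ (k + m) - inputTime τ m := by
  simp only [inputTime, Finset.range_eq_Ico, Finset.sum_Ico_add' (fun j => τ j) 0 k m]
  rw [eq_sub_iff_add_eq, add_comm, zero_add, Finset.sum_Ico_consecutive _ (Nat.zero_le _) (by omega)]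

lemma strictMono_inputTime {τ : ℕ → ℝ} (hτ : ∀ k, 0 < τ k) : StrictMono (inputTime τ) :=
  strictMono_nat_of_lt_succ fun k => by
    simpa [inputTime, Finset.sum_range_succ] using hτ k

/-- The indices of the input times that are received by a node with off-durations `R`. -/
def receivedIdx (τ R : ℕ → ℝ) : ℕ → ℕ
  | 0 => 0
  | k + 1 => passIdx (fun j => τ (j + receivedIdx τ R k)) (R k) + receivedIdx τ R k

lemma lt_inputTime_passIdx {τ : ℕ → ℝ} (hT : Tendsto (inputTime τ) atTop atTop) (r : ℝ) :
    r < inputTime τ (passIdx τ r) :=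
  Nat.sInf_mem (s := {m | r < inputTime τ m}) (hT.eventually_gt_atTop r).exists

lemma inputTime_le_of_lt_passIdx {τ : ℕ → ℝ} {r : ℝ} {m : ℕ} (h : m < passIdx τ r) :
    inputTime τ m ≤ r :=
  not_lt.1 fun h' => Nat.notMem_of_lt_sInf h h'

lemma tendsto_inputTime_shift {τ : ℕ → ℝ} (hT : Tendsto (inputTime τ) atTop atTop) (m : ℕ) :
    Tendsto (inputTime fun j => τ (j + m)) atTop atTop := by
  have : (inputTime fun j => τ (j + m)) = fun k => inputTime τ (k + m) - inputTime τ m :=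
    funext (inputTime_shift τ m)
  rw [this]
  exact tendsto_atTop_add_const_right _ _ ((tendsto_add_atTop_iff_nat m).2 hT)

lemma receivedIdx_lt_succ {τ R : ℕ → ℝ} (hT : Tendsto (inputTime τ) atTop atTop)
    {k : ℕ} (hR : 0 ≤ R k) : receivedIdx τ R k < receivedIdx τ R (k + 1) := by
  have := lt_inputTime_passIdx (tendsto_inputTime_shift hT (receivedIdx τ R k)) (R k)
  have hpos : passIdx (fun j => τ (j + receivedIdx τ R k)) (R k) ≠ 0 := fun h0 => by
    rw [h0] at this
    simp only [inputTime, Finset.range_zero, Finset.sum_empty] at this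
    linarith
  simp only [receivedIdx]
  omega

/-- The rules for the path of the rightmost node of an on-off system. -/
structure IsLastPath (τ : ℕ → ℝ) (x : ℝ → Bool) : Prop where
  start : x 0 = false
  cadlag : IsCadlag x
  signal : ∀ t, 0 < t → (Receives x t ↔ (∃ m, t = inputTime τ m) ∧ OnBefore x t)

/-- Between its recovery and the next input nothing can switch the node off, so that input is
received. The input must come strictly after the recovery: at the instant of recovery the node is
off just before. -/
lemma IsLastPath.isLeast_of_eq {τ : ℕ → ℝ} {x : ℝ → Bool} (hx : IsLastPath τ x)
    (hτ : ∀ k, 0 < τ k) (hT : Tendsto (inputTime τ) atTop atTop) {k m : ℕ}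
    (hoff : 0 < offDuration x k) (hm : receptionTime x k = inputTime τ m)
    (hk : x (receptionTime x k) = false) :
    IsLeast {t | receptionTime x k < t ∧ Receives x t}
      (inputTime τ (passIdx (fun j => τ (j + m)) (offDuration x k) + m)) := by
  obtain ⟨hfalse, htrue⟩ := hx.cadlag.recovery_spec hoff hk
  have h0 := receptionTime_nonneg x k
  set N := passIdx (fun j => τ (j + m)) (offDuration x k) with hN
  have hR : recoveryTime x k = inputTime τ m + offDuration x k := by
    rw [offDuration, ← hm]; ring
  have hNlt : recoveryTime x k < inputTime τ (N + m) := by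
    have := lt_inputTime_passIdx (tendsto_inputTime_shift hT m) (offDuration x k)
    rw [inputTime_shift] at this
    rw [hR]; linarith
  have hNle : ∀ l, inputTime τ l < inputTime τ (N + m) → inputTime τ l ≤ recoveryTime x k := by
    intro l hl
    have hl' : l < N + m := (strictMono_inputTime hτ).lt_iff_lt.1 hl
    rcases lt_or_ge l m with h | h
    · have := (strictMono_inputTime hτ) h
      rw [hR]; linarith
    · have := inputTime_le_of_lt_passIdx (τ := fun j => τ (j + m)) (r := offDuration x k)
        (m := l - m) (by omega)
      rw [inputTime_shift, Nat.sub_add_cancel h] at this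
      rw [hR]; linarith
  have hlt : receptionTime x k < recoveryTime x k := by rw [hR, hm]; linarith
  have hpos : 0 < recoveryTime x k := h0.trans_lt hlt
  have hon : ∀ s, recoveryTime x k ≤ s → s < inputTime τ (N + m) → x s = true := by
    intro s hs hsN
    -- The first switch-off would be a reception, hence an input time strictly between the recovery
    -- and input `N + m`; there is none.
    by_contra hne
    obtain ⟨u, hu, hus, hub, hxu⟩ := hx.cadlag.exists_first_change hpos.le hs htrue hne
    have hu0 := hpos.trans hu
    obtain ⟨⟨l, rfl⟩, -⟩ := (hx.signal u hu0).1
      ⟨hu0, eventually_nhdsLT_of_forall hu hub, by simpa using hxu⟩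
    exact absurd (hNle l (hus.trans_lt hsN)) (not_le.2 hu)
  constructor
  · exact ⟨hlt.trans hNlt, (hx.signal _ (hpos.trans hNlt)).2
      ⟨⟨_, rfl⟩, eventually_nhdsLT_of_forall hNlt hon⟩⟩
  · rintro t ⟨ht, hrec⟩
    by_contra! htN
    rcases le_or_gt t (recoveryTime x k) with h | h
    · refine not_onBefore_of_offBefore (eventually_nhdsLT_of_forall ht fun s hs hst => ?_) hrec.2.1
      exact hfalse s hs (hst.trans_le h)
    · have := hon t h.le htN
      simp [hrec.2.2] at this

lemma receptionTime_succ_of_isLeast {x : ℝ → Bool} {k : ℕ} {t : ℝ}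
    (h : IsLeast {t | receptionTime x k < t ∧ Receives x t} t) :
    receptionTime x (k + 1) = t := h.csInf_eq

lemma IsLastPath.receptionTime_eq {τ : ℕ → ℝ} {x : ℝ → Bool} (hx : IsLastPath τ x)
    (hτ : ∀ k, 0 < τ k) (hT : Tendsto (inputTime τ) atTop atTop)
    (hoff : ∀ k, 0 < offDuration x k) (k : ℕ) :
    receptionTime x k = inputTime τ (receivedIdx τ (offDuration x) k) ∧
      x (receptionTime x k) = false := by
  induction k with
  | zero => exact ⟨by simp [receptionTime, receivedIdx, inputTime], hx.start⟩
  | succ k ih =>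
    have h := hx.isLeast_of_eq hτ hT (hoff k) ih.1 ih.2
    have heq := receptionTime_succ_of_isLeast h
    exact ⟨heq, heq ▸ h.1.2.2.2⟩

lemma IsLastPath.isLeast {τ : ℕ → ℝ} {x : ℝ → Bool} (hx : IsLastPath τ x)
    (hτ : ∀ k, 0 < τ k) (hT : Tendsto (inputTime τ) atTop atTop)
    (hoff : ∀ k, 0 < offDuration x k) (k : ℕ) :
    IsLeast {t | receptionTime x k < t ∧ Receives x t} (receptionTime x (k + 1)) := by
  obtain ⟨h1, h2⟩ := hx.receptionTime_eq hτ hT hoff k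
  have h := hx.isLeast_of_eq hτ hT (hoff k) h1 h2
  rwa [receptionTime_succ_of_isLeast h]

lemma inputTime_interreceptionTime (x : ℝ → Bool) (m : ℕ) :
    inputTime (interreceptionTime x) m = receptionTime x m := by
  simp only [inputTime, interreceptionTime]
  rw [Finset.sum_range_sub]
  simp [receptionTime]

lemma IsLastPath.receives_iff {τ : ℕ → ℝ} {x : ℝ → Bool} (hx : IsLastPath τ x)
    (hτ : ∀ k, 0 < τ k) (hT : Tendsto (inputTime τ) atTop atTop)
    (hoff : ∀ k, 0 < offDuration x k) {t : ℝ} (ht : 0 < t) :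
    Receives x t ↔ ∃ m, t = inputTime (interreceptionTime x) m := by
  simp only [inputTime_interreceptionTime]
  constructor
  · intro h
    have hmono : StrictMono (receivedIdx τ (offDuration x)) :=
      strictMono_nat_of_lt_succ fun k => receivedIdx_lt_succ hT (hoff k).le
    -- The received indices increase strictly, so the `k`-th reception is no earlier than the `k`-th
    -- input, and the inputs tend to infinity.
    have hex : ∃ k, t ≤ receptionTime x k := by
      obtain ⟨k, hk⟩ := (hT.eventually_ge_atTop t).exists
      refine ⟨k, hk.trans ?_⟩
      rw [(hx.receptionTime_eq hτ hT hoff k).1]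
      exact (strictMono_inputTime hτ).monotone hmono.le_apply
    classical
    refine ⟨Nat.find hex, le_antisymm (Nat.find_spec hex) ?_⟩
    rcases hk : Nat.find hex with _ | k
    · exact ht.le
    · have hlt : receptionTime x k < t := not_le.1 (Nat.find_min hex (by omega))
      exact (hx.isLeast hτ hT hoff k).2 ⟨hlt, h⟩
  · rintro ⟨m, rfl⟩
    cases m with
    | zero => exact absurd ht (lt_irrefl _)
    | succ m => exact (hx.isLeast hτ hT hoff m).1.2

lemma IsOnOffPath.isLastPath {n : ℕ} {τ : ℕ → ℝ} {x : Fin (n + 1) → ℝ → Bool}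
    (hx : IsOnOffPath τ x) : IsLastPath τ (x (Fin.last n)) where
  start := hx.start _
  cadlag := hx.cadlag _
  signal t ht := by
    rw [hx.signal _ t ht]
    refine and_congr_right fun _ => ⟨fun h => h _ le_rfl, fun h j hj => ?_⟩
    rwa [Fin.last_le_iff.1 hj]

/-- The nodes to the left of the rightmost one form an on-off system whose input intervals are the
interreception times of the rightmost node. -/
lemma IsOnOffPath.castSucc {n : ℕ} {τ : ℕ → ℝ} {x : Fin (n + 1) → ℝ → Bool}
    (hx : IsOnOffPath τ x) (hτ : ∀ k, 0 < τ k) (hT : Tendsto (inputTime τ) atTop atTop)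
    (hoff : ∀ k, 0 < offDuration (x (Fin.last n)) k) :
    IsOnOffPath (interreceptionTime (x (Fin.last n))) (fun i => x i.castSucc) where
  start _ := hx.start _
  cadlag _ := hx.cadlag _
  signal i t ht := by
    -- An input time at which the last node is on just before is exactly a reception of the last
    -- node; the rest of the condition concerns the other nodes.
    rw [hx.signal _ t ht, ← hx.isLastPath.receives_iff hτ hT hoff ht,
      hx.isLastPath.signal t ht]
    constructor
    · exact fun ⟨h1, h2⟩ => ⟨⟨h1, h2 _ (Fin.le_last _)⟩, fun j hj => h2 _ (by simpa using hj)⟩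
    · rintro ⟨⟨h1, h2⟩, h3⟩
      refine ⟨h1, fun j hj => ?_⟩
      induction j using Fin.lastCases with
      | last => exact h2
      | cast j => exact h3 j (by simpa using hj)

/-! ### Product measures and independence -/

section General

variable {α β : Type*}

instance isProbabilityMeasure_sumElim {μ : α → Measure ℝ} {μ' : β → Measure ℝ}
    [∀ i, IsProbabilityMeasure (μ i)] [∀ i, IsProbabilityMeasure (μ' i)] (i : α ⊕ β) :
    IsProbabilityMeasure (Sum.elim μ μ' i) := by
  cases i <;> simp only [Sum.elim_inl, Sum.elim_inr] <;> infer_instance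

lemma measurable_sumElim :
    Measurable fun p : (α → ℝ) × (β → ℝ) => (Sum.elim p.1 p.2 : α ⊕ β → ℝ) := by
  refine measurable_pi_iff.2 fun i => ?_
  cases i <;> simp only [Sum.elim_inl, Sum.elim_inr] <;> fun_prop

lemma map_sumElim_prod_infinitePi (μ : α → Measure ℝ) (μ' : β → Measure ℝ)
    [∀ i, IsProbabilityMeasure (μ i)] [∀ i, IsProbabilityMeasure (μ' i)] :
    ((Measure.infinitePi μ).prod (Measure.infinitePi μ')).map
      (fun p => (Sum.elim p.1 p.2 : α ⊕ β → ℝ)) = Measure.infinitePi (Sum.elim μ μ') := by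
  refine Measure.eq_infinitePi _ fun s t ht => ?_
  have hpre : (fun p : (α → ℝ) × (β → ℝ) => (Sum.elim p.1 p.2 : α ⊕ β → ℝ)) ⁻¹' (Set.pi s t) =
      (Set.pi s.toLeft fun i => t (Sum.inl i)) ×ˢ (Set.pi s.toRight fun i => t (Sum.inr i)) := by
    ext p
    simp [Set.mem_pi]
  rw [Measure.map_apply measurable_sumElim (.pi s.countable_toSet fun i _ => ht i), hpre,
    Measure.prod_prod, Measure.infinitePi_pi _ fun i _ => ht _,
    Measure.infinitePi_pi _ fun i _ => ht _]
  conv_rhs => rw [← s.toLeft_disjSum_toRight, Finset.prod_disjSum]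
  simp

lemma map_infinitePi_sumElim (μ : α → Measure ℝ) (μ' : β → Measure ℝ)
    [∀ i, IsProbabilityMeasure (μ i)] [∀ i, IsProbabilityMeasure (μ' i)] :
    (Measure.infinitePi (Sum.elim μ μ')).map (fun w => (fun i => w (Sum.inl i),
      fun i => w (Sum.inr i))) = (Measure.infinitePi μ).prod (Measure.infinitePi μ') := by
  rw [← map_sumElim_prod_infinitePi, Measure.map_map (by fun_prop) measurable_sumElim]
  exact Measure.map_id

lemma measurable_of_countable_index {ι E F : Type*} [Countable ι] [MeasurableSpace ι]
    [MeasurableSingletonClass ι] [MeasurableSpace E]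
    [MeasurableSpace F] {N : E → ι} (hN : Measurable N) {g : ι → E → F}
    (hg : ∀ n, Measurable (g n)) : Measurable fun w => g (N w) w :=
  (measurable_from_prod_countable_right (f := fun p : ι × E => g p.1 p.2) hg).comp
    (hN.prodMk measurable_id)

lemma measurable_pi_of_measurable_apply {E : Type*} {m : MeasurableSpace E} {f : E → α → ℝ}
    (h : ∀ i, Measurable fun x => f x i) : Measurable f :=
  measurable_pi_iff.2 h

lemma measure_eq_tsum_inter {E : Type*} [MeasurableSpace E] {μ : Measure E} {A : ℕ → Set E}
    (hA : ∀ m, MeasurableSet (A m)) (hd : Pairwise (Function.onFun Disjoint A))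
    (hcov : ∀ᵐ w ∂μ, ∃ m, w ∈ A m) {s : Set E} (hs : MeasurableSet s) :
    μ s = ∑' m, μ (s ∩ A m) := by
  rw [← measure_iUnion (fun i j hij => (hd hij).mono Set.inter_subset_right Set.inter_subset_right)
    fun m => hs.inter (hA m), ← Set.inter_iUnion]
  refine measure_congr ?_
  filter_upwards [hcov] with w hw
  refine propext ⟨fun h => ⟨h, Set.mem_iUnion.2 hw⟩, fun h => h.1⟩

/-- If the law of `(f, g)` is the product of the law of `f` and the original measure, then the
values of `f` along the orbits of `g` are independent and identically distributed. -/
lemma map_orbit_eq_infinitePi {E : Type*} [MeasurableSpace E] {Q : Measure E}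
    [IsProbabilityMeasure Q] {f : E → ℝ} {g : E → E} (hf : Measurable f) (hg : Measurable g)
    (h : Q.map (fun w => (f w, g w)) = (Q.map f).prod Q) :
    Q.map (fun w k => f (g^[k] w)) = Measure.infinitePi fun _ : ℕ => Q.map f := by
  have hfg : ∀ k, Measurable fun w => f (g^[k] w) := fun k => hf.comp (hg.iterate k)
  -- Cylinder sets: the hypothesis splits off coordinate 0, and the rest is a cylinder with one
  -- coordinate fewer, evaluated at `g w`.
  have key : ∀ K (t : ℕ → Set ℝ), (∀ k, MeasurableSet (t k)) →
      Q {w | ∀ k < K, f (g^[k] w) ∈ t k} = ∏ k ∈ Finset.range K, Q.map f (t k) := by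
    intro K
    induction K with
    | zero => intro t _; simp
    | succ K ih =>
      intro t ht
      have hset : {w | ∀ k < K + 1, f (g^[k] w) ∈ t k} =
          (fun w => (f w, g w)) ⁻¹' (t 0 ×ˢ {w | ∀ k < K, f (g^[k] w) ∈ t (k + 1)}) := by
        ext w
        simp only [Set.mem_ofPred_eq, Set.mem_preimage, Set.mem_prod, Nat.forall_lt_succ_left,
          Function.iterate_zero, id_eq, Function.iterate_succ_apply]
      have hm : MeasurableSet {w | ∀ k < K, f (g^[k] w) ∈ t (k + 1)} := by
        simp only [Set.ofPred_forall]
        exact .iInter fun k => .iInter fun _ => hfg k (ht _)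
      rw [hset, ← Measure.map_apply (hf.prodMk hg) ((ht 0).prod hm), h, Measure.prod_prod,
        ih _ fun k => ht _, Finset.prod_range_succ', mul_comm]
  have : IsProbabilityMeasure (Q.map f) := Measure.isProbabilityMeasure_map hf.aemeasurable
  refine Measure.eq_infinitePi _ fun s t ht => ?_
  classical
  obtain ⟨K, hK⟩ := s.exists_nat_subset_range
  have hset : (fun w k => f (g^[k] w)) ⁻¹' (Set.pi s t) =
      {w | ∀ k < K, f (g^[k] w) ∈ if k ∈ s then t k else Set.univ} := by
    ext w
    simp only [Set.mem_preimage, Set.mem_pi, Set.mem_ofPred_eq, Finset.mem_coe]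
    refine ⟨fun hw k _ => ?_, fun hw k hk => ?_⟩
    · split_ifs with hk
      exacts [hw k hk, trivial]
    · simpa [hk] using hw k (Finset.mem_range.1 (hK hk))
  rw [Measure.map_apply (by fun_prop) (.pi s.countable_toSet fun i _ => ht i), hset,
    key _ _ fun k => by split_ifs; exacts [ht k, .univ]]
  rw [← Finset.prod_subset hK fun k _ hk => by simp [hk]]
  exact Finset.prod_congr rfl fun k hk => by simp [hk]

/-- A law on the positive reals charges some `(δ, ∞)`. By the second Borel–Cantelli lemma infinitely
many intervals exceed `δ`, so their sum diverges. -/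
lemma ae_tendsto_inputTime (ν : Measure ℝ) [IsProbabilityMeasure ν] (hν : ν (Set.Iic 0) = 0) :
    ∀ᵐ w ∂Measure.infinitePi fun _ : ℕ => ν,
      (∀ k, 0 < w k) ∧ Tendsto (inputTime w) atTop atTop := by
  have hpos : ∀ᵐ w ∂Measure.infinitePi fun _ : ℕ => ν, ∀ k, 0 < w k := by
    refine ae_all_iff.2 fun k => ?_
    have hae : ∀ᵐ x ∂ν, 0 < x := by
      rw [ae_iff]; simpa [Set.Iic] using hν
    exact (measurePreserving_eval_infinitePi (fun _ : ℕ => ν) k).quasiMeasurePreserving.ae hae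
  obtain ⟨δ, hδ, hνδ⟩ : ∃ δ > 0, ν (Set.Ioi δ) ≠ 0 := by
    by_contra! hcon
    have hu : Set.Ioi (0 : ℝ) ⊆ ⋃ n : ℕ, Set.Ioi (1 / ((n : ℝ) + 1)) := fun x hx => by
      obtain ⟨n, hn⟩ := exists_nat_one_div_lt (show (0 : ℝ) < x from hx)
      exact Set.mem_iUnion.2 ⟨n, hn⟩
    have h0 : ν (Set.Ioi 0) = 0 :=
      measure_mono_null hu (measure_iUnion_null fun n => hcon _ (by positivity))
    have : ν Set.univ = 0 := by
      rw [← Set.Iic_union_Ioi (a := (0 : ℝ))]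
      exact measure_union_null hν h0
    simp at this
  have hms : ∀ k : ℕ, MeasurableSet {w : ℕ → ℝ | δ < w k} := fun k =>
    measurableSet_lt measurable_const (measurable_pi_apply k)
  have hmeas : ∀ k : ℕ, (Measure.infinitePi fun _ : ℕ => ν) {w | δ < w k} = ν (Set.Ioi δ) := by
    intro k
    conv_rhs => rw [← Measure.infinitePi_map_eval (fun _ : ℕ => ν) k,
      Measure.map_apply (measurable_pi_apply k) measurableSet_Ioi]
    rfl
  have hindep : iIndepSet (fun k => {w : ℕ → ℝ | δ < w k})
      (Measure.infinitePi fun _ : ℕ => ν) := by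
    refine (iIndepSet_iff_meas_biInter hms).2 fun s => ?_
    have := Measure.infinitePi_pi (fun _ : ℕ => ν) (s := s) (t := fun _ => Set.Ioi δ)
      fun _ _ => measurableSet_Ioi
    simp_rw [hmeas]
    rw [← this]
    congr 1
    ext w
    simp [Set.mem_pi]
  have hlim := measure_limsup_eq_one hms hindep (by
    simp_rw [hmeas]; exact ENNReal.tsum_const_eq_top_of_ne_zero hνδ)
  have hlim' : ∀ᵐ w ∂Measure.infinitePi fun _ : ℕ => ν,
      w ∈ limsup (fun k => {w : ℕ → ℝ | δ < w k}) atTop :=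
    (prob_compl_eq_zero_iff (MeasurableSet.measurableSet_limsup hms)).2 hlim
  filter_upwards [hpos, hlim'] with w hw hw'
  refine ⟨hw, (not_summable_iff_tendsto_nat_atTop_of_nonneg fun k => (hw k).le).1 fun hsum => ?_⟩
  rw [mem_limsup_iff_frequently_mem] at hw'
  refine hw' ?_
  filter_upwards [hsum.tendsto_atTop_zero.eventually_lt_const hδ] with k hk
  exact not_lt.2 hk.le

end General

/-! ### The canonical space of one node -/

/-- The joint law of independent input intervals (law `ν`) and off-durations (law `κ`). -/
def drivingLaw (ν κ : Measure ℝ) : Measure (ℕ ⊕ ℕ → ℝ) :=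
  Measure.infinitePi (Sum.elim (fun _ => ν) (fun _ => κ))

/-- The index of the input at the first reception. -/
def firstIdx (w : ℕ ⊕ ℕ → ℝ) : ℕ := passIdx (fun j => w (Sum.inl j)) (w (Sum.inr 0))

/-- The input times on the canonical space. -/
def inputs (m : ℕ) (w : ℕ ⊕ ℕ → ℝ) : ℝ := inputTime (fun j => w (Sum.inl j)) m

/-- The time of the first reception. -/
def firstReception (w : ℕ ⊕ ℕ → ℝ) : ℝ := inputs (firstIdx w) w

/-- Delete the first `m` input intervals and the first off-duration. -/
def dropData (m : ℕ) (w : ℕ ⊕ ℕ → ℝ) : ℕ ⊕ ℕ → ℝ := fun i => w (Sum.map (· + m) (· + 1) i)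

/-- The data after the first reception. -/
def afterReception (w : ℕ ⊕ ℕ → ℝ) : ℕ ⊕ ℕ → ℝ := dropData (firstIdx w) w

/-- The `m`-th input time is the first one after the first off-duration. -/
def passEvent (m : ℕ) : Set (ℕ ⊕ ℕ → ℝ) :=
  {w | w (Sum.inr 0) < inputs m w ∧ ∀ j < m, inputs j w ≤ w (Sum.inr 0)}

lemma firstIdx_of_mem_passEvent {m : ℕ} {w : ℕ ⊕ ℕ → ℝ} (hw : w ∈ passEvent m) :
    firstIdx w = m := by
  refine le_antisymm (Nat.sInf_le hw.1) (not_lt.1 fun h => ?_)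
  have hmem : w (Sum.inr 0) < inputs (firstIdx w) w :=
    Nat.sInf_mem (s := {m | w (Sum.inr 0) < inputTime (fun j => w (Sum.inl j)) m}) ⟨m, hw.1⟩
  exact absurd (hw.2 _ h) (not_le.2 hmem)

lemma pairwise_disjoint_passEvent : Pairwise (Function.onFun Disjoint passEvent) :=
  fun _ _ hij => Set.disjoint_left.2 fun _ hi hj =>
    hij ((firstIdx_of_mem_passEvent hi).symm.trans (firstIdx_of_mem_passEvent hj))

lemma measurable_inputs (m : ℕ) : Measurable (inputs m) := by
  unfold inputs inputTime; fun_prop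

lemma measurableSet_passEvent (m : ℕ) : MeasurableSet (passEvent m) := by
  unfold passEvent
  simp only [Set.ofPred_and, Set.ofPred_forall]
  exact (measurableSet_lt (measurable_pi_apply _) (measurable_inputs m)).inter
    (.iInter fun j => .iInter fun _ =>
      measurableSet_le (measurable_inputs j) (measurable_pi_apply _))

lemma mem_passEvent_firstIdx {w : ℕ ⊕ ℕ → ℝ} (hw : ∃ m, w (Sum.inr 0) < inputs m w) :
    w ∈ passEvent (firstIdx w) :=
  ⟨Nat.sInf_mem (s := {m | w (Sum.inr 0) < inputTime (fun j => w (Sum.inl j)) m}) hw,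
    fun _ hj => inputTime_le_of_lt_passIdx hj⟩

lemma firstIdx_eq_zero {w : ℕ ⊕ ℕ → ℝ} (hw : ¬ ∃ m, w (Sum.inr 0) < inputs m w) :
    firstIdx w = 0 := by
  have : {m | w (Sum.inr 0) < inputTime (fun j => w (Sum.inl j)) m} = ∅ :=
    Set.eq_empty_of_forall_notMem fun m hm => hw ⟨m, hm⟩
  rw [firstIdx, passIdx, this, Nat.sInf_empty]

lemma measurable_firstIdx : Measurable firstIdx := by
  refine measurable_to_countable' fun m => ?_
  -- Points where no input exceeds the off-duration get the default index 0.
  have hset : firstIdx ⁻¹' {m} = passEvent m ∪ {w | m = 0 ∧ ∀ l, w ∉ passEvent l} := by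
    ext w
    simp only [Set.mem_preimage, Set.mem_singleton_iff, Set.mem_union, Set.mem_ofPred_eq]
    constructor
    · rintro rfl
      by_cases hex : ∃ m, w (Sum.inr 0) < inputs m w
      · exact Or.inl (mem_passEvent_firstIdx hex)
      · exact Or.inr ⟨firstIdx_eq_zero hex, fun l hl => hex ⟨l, hl.1⟩⟩
    · rintro (h | ⟨rfl, h⟩)
      · exact firstIdx_of_mem_passEvent h
      · exact firstIdx_eq_zero fun hex => h _ (mem_passEvent_firstIdx hex)
  rw [hset]
  refine (measurableSet_passEvent m).union ((MeasurableSet.const _).inter ?_)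
  have hnone : {w | ∀ l, w ∉ passEvent l} = ⋂ l, (passEvent l)ᶜ := by
    ext w
    simp
  change MeasurableSet {w | ∀ l, w ∉ passEvent l}
  rw [hnone]
  exact .iInter fun l => (measurableSet_passEvent l).compl

lemma measurable_firstReception : Measurable firstReception :=
  measurable_of_countable_index measurable_firstIdx measurable_inputs

lemma measurable_dropData (m : ℕ) : Measurable (dropData m) := by
  unfold dropData; fun_prop

lemma measurable_afterReception : Measurable afterReception :=
  measurable_of_countable_index measurable_firstIdx measurable_dropData

/-! ### Renewal at the first reception -/

section DrivingLaw

variable {ν κ : Measure ℝ} [IsProbabilityMeasure ν] [IsProbabilityMeasure κ]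

instance : IsProbabilityMeasure (drivingLaw ν κ) := by
  unfold drivingLaw; infer_instance

lemma map_dropData (m : ℕ) : (drivingLaw ν κ).map (dropData m) = drivingLaw ν κ := by
  have hinj : Function.Injective (Sum.map (· + m) (· + 1) : ℕ ⊕ ℕ → ℕ ⊕ ℕ) :=
    (add_left_injective m).sumMap (add_left_injective 1)
  have := Measure.map_infinitePi_infinitePi_of_inj
    (P := (Sum.elim (fun _ => ν) (fun _ => κ) : ℕ ⊕ ℕ → Measure ℝ)) hinj
  unfold drivingLaw dropData
  rw [this]
  congr 1
  ext1 i
  cases i <;> rfl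

lemma ae_drivingLaw (hν : ν (Set.Iic 0) = 0) (hκ : κ (Set.Iic 0) = 0) :
    ∀ᵐ w ∂drivingLaw ν κ, (∀ k, 0 < w (Sum.inl k)) ∧
      Tendsto (fun m => inputs m w) atTop atTop ∧ ∀ k, 0 < w (Sum.inr k) := by
  have h1 : (drivingLaw ν κ).map (fun w i => w (Sum.inl i)) =
      Measure.infinitePi fun _ : ℕ => ν :=
    Measure.map_infinitePi_infinitePi_of_inj
      (P := (Sum.elim (fun _ => ν) (fun _ => κ) : ℕ ⊕ ℕ → Measure ℝ)) Sum.inl_injective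
  have h2 : (drivingLaw ν κ).map (fun w i => w (Sum.inr i)) =
      Measure.infinitePi fun _ : ℕ => κ :=
    Measure.map_infinitePi_infinitePi_of_inj
      (P := (Sum.elim (fun _ => ν) (fun _ => κ) : ℕ ⊕ ℕ → Measure ℝ)) Sum.inr_injective
  have a1 := ae_tendsto_inputTime ν hν
  have a2 := ae_tendsto_inputTime κ hκ
  rw [← h1] at a1
  rw [← h2] at a2
  filter_upwards [ae_of_ae_map (Measurable.aemeasurable (by fun_prop)) a1,
    ae_of_ae_map (Measurable.aemeasurable (by fun_prop)) a2] with w b1 b2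
  exact ⟨b1.1, b1.2, b2.1⟩

lemma ae_mem_passEvent (hν : ν (Set.Iic 0) = 0) (hκ : κ (Set.Iic 0) = 0) :
    ∀ᵐ w ∂drivingLaw ν κ, ∃ m, w ∈ passEvent m := by
  filter_upwards [ae_drivingLaw hν hκ] with w hw
  exact ⟨_, mem_passEvent_firstIdx (hw.2.1.eventually_gt_atTop _).exists⟩

/-- The first event depends only on the first `m` input intervals and the first off-duration, the
second only on the remaining coordinates. Disjoint families of independent coordinates are
independent. -/
lemma measure_inter_preimage_dropData (m : ℕ) {A : Set ℝ} (hA : MeasurableSet A)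
    {B : Set (ℕ ⊕ ℕ → ℝ)} (hB : MeasurableSet B) :
    drivingLaw ν κ ((passEvent m ∩ inputs m ⁻¹' A) ∩ dropData m ⁻¹' B) =
      drivingLaw ν κ (passEvent m ∩ inputs m ⁻¹' A) * drivingLaw ν κ B := by
  classical
  set S : Set (ℕ ⊕ ℕ) := {i | i = Sum.inr 0 ∨ ∃ j < m, i = Sum.inl j} with hS
  set T : Set (ℕ ⊕ ℕ) := Set.range (Sum.map (· + m) (· + 1)) with hT
  have hdisj : Disjoint S T := by
    rw [Set.disjoint_left]
    rintro _ (rfl | ⟨j, hj, rfl⟩) ⟨i, hi⟩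
    · cases i <;> simp at hi
    · cases i <;> simp at hi
      omega
  have hind : iIndepFun (fun (i : ℕ ⊕ ℕ) (w : ℕ ⊕ ℕ → ℝ) => w i) (drivingLaw ν κ) :=
    iIndepFun_infinitePi (P := (Sum.elim (fun _ => ν) (fun _ => κ) : ℕ ⊕ ℕ → Measure ℝ))
      (X := fun _ x => x) fun _ => measurable_id
  have hindep := indep_iSup_of_disjoint (fun i => (measurable_pi_apply i).comap_le) hind.iIndep hdisj
  have heval : ∀ (U : Set (ℕ ⊕ ℕ)) i, i ∈ U → Measurable[⨆ i ∈ U, MeasurableSpace.comap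
      (fun w : ℕ ⊕ ℕ → ℝ => w i) inferInstance] fun w : ℕ ⊕ ℕ → ℝ => w i := fun U i hi =>
    (comap_measurable _).mono (le_iSup₂ (f := fun i (_ : i ∈ U) => MeasurableSpace.comap
      (fun w : ℕ ⊕ ℕ → ℝ => w i) inferInstance) i hi) le_rfl
  have hhead : MeasurableSet[⨆ i ∈ S, MeasurableSpace.comap
      (fun w : ℕ ⊕ ℕ → ℝ => w i) inferInstance] (passEvent m ∩ inputs m ⁻¹' A) := by
    -- Zeroing the coordinates outside `S` is measurable for the σ-algebra of `S` and does not
    -- affect the event.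
    let z : (ℕ ⊕ ℕ → ℝ) → (ℕ ⊕ ℕ → ℝ) := fun w i => if i ∈ S then w i else 0
    have hz : Measurable[⨆ i ∈ S, MeasurableSpace.comap
      (fun w : ℕ ⊕ ℕ → ℝ => w i) inferInstance] z := by
      refine measurable_pi_of_measurable_apply fun i => ?_
      by_cases hi : i ∈ S
      · simpa only [z, if_pos hi] using heval S i hi
      · simp only [z, if_neg hi]
        exact measurable_const
    have hzin : ∀ w, ∀ j ≤ m, inputs j (z w) = inputs j w := fun w j hj => by
      unfold inputs inputTime
      refine Finset.sum_congr rfl fun l hl => if_pos (show Sum.inl l ∈ S from ?_)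
      exact Or.inr ⟨l, (Finset.mem_range.1 hl).trans_le hj, rfl⟩
    have hzr : ∀ w, z w (Sum.inr 0) = w (Sum.inr 0) := fun w => if_pos (Or.inl rfl)
    have hset : passEvent m ∩ inputs m ⁻¹' A = z ⁻¹' (passEvent m ∩ inputs m ⁻¹' A) := by
      ext w
      simp only [passEvent, Set.mem_inter_iff, Set.mem_ofPred_eq, Set.mem_preimage, hzr,
        hzin w m le_rfl]
      refine and_congr_left fun _ => and_congr_right fun _ => forall₂_congr fun j hj => ?_
      rw [hzin w j hj.le]
    rw [hset]
    exact hz ((measurableSet_passEvent m).inter (measurable_inputs m hA))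
  have htail : MeasurableSet[⨆ i ∈ T, MeasurableSpace.comap
      (fun w : ℕ ⊕ ℕ → ℝ => w i) inferInstance] (dropData m ⁻¹' B) := by
    have : Measurable[⨆ i ∈ T, MeasurableSpace.comap
        (fun w : ℕ ⊕ ℕ → ℝ => w i) inferInstance] (dropData m) :=
      measurable_pi_of_measurable_apply fun i => heval T _ ⟨i, rfl⟩
    exact this hB
  rw [(Indep_iff _ _ _).1 hindep _ _ hhead htail,
    ← Measure.map_apply (measurable_dropData m) hB, map_dropData]

/-- The data after the first reception are independent of the first reception time, and have the
law of the original data. -/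
lemma map_firstReception_afterReception (hν : ν (Set.Iic 0) = 0) (hκ : κ (Set.Iic 0) = 0) :
    (drivingLaw ν κ).map (fun w => (firstReception w, afterReception w)) =
      ((drivingLaw ν κ).map firstReception).prod (drivingLaw ν κ) := by
  have : IsProbabilityMeasure ((drivingLaw ν κ).map firstReception) :=
    Measure.isProbabilityMeasure_map measurable_firstReception.aemeasurable
  refine (Measure.prod_eq fun A B hA hB => ?_).symm
  -- On each `passEvent m` the random index is the constant `m`, which reduces the claim to a fixed
  -- number of deleted inputs.
  have hsum := fun s hs => measure_eq_tsum_inter (s := s) measurableSet_passEvent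
    pairwise_disjoint_passEvent (ae_mem_passEvent hν hκ) hs
  rw [Measure.map_apply (measurable_firstReception.prodMk measurable_afterReception) (hA.prod hB),
    Measure.map_apply measurable_firstReception hA,
    hsum _ ((measurable_firstReception.prodMk measurable_afterReception) (hA.prod hB)),
    hsum _ (measurable_firstReception hA), ← ENNReal.tsum_mul_right]
  congr 1
  ext1 m
  have h1 : (firstReception ⁻¹' A) ∩ passEvent m = passEvent m ∩ inputs m ⁻¹' A := by
    ext w
    simp only [Set.mem_inter_iff, Set.mem_preimage, firstReception]
    rw [and_comm]
    exact and_congr_right fun h => by rw [firstIdx_of_mem_passEvent h]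
  have h2 : ((fun w => (firstReception w, afterReception w)) ⁻¹' (A ×ˢ B)) ∩ passEvent m =
      (passEvent m ∩ inputs m ⁻¹' A) ∩ dropData m ⁻¹' B := by
    ext w
    simp only [Set.mem_inter_iff, Set.mem_preimage, Set.mem_prod, firstReception, afterReception]
    rw [and_comm, and_assoc]
    exact and_congr_right fun h => by rw [firstIdx_of_mem_passEvent h]
  rw [h1, h2, measure_inter_preimage_dropData m hA hB]

end DrivingLaw

/-- The interreception time law of a node with off-duration law `κ` and input interval law `ν`. -/
def thin (κ ν : Measure ℝ) : Measure ℝ := (drivingLaw ν κ).map firstReception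

/-- The sequence of interreception times on the canonical space. -/
def receptions (w : ℕ ⊕ ℕ → ℝ) (k : ℕ) : ℝ := firstReception (afterReception^[k] w)

lemma measurable_receptions : Measurable receptions :=
  measurable_pi_iff.2 fun k =>
    measurable_firstReception.comp (measurable_afterReception.iterate k)

lemma iterate_afterReception (w : ℕ ⊕ ℕ → ℝ) (k : ℕ) :
    afterReception^[k] w = Sum.elim
      (fun j => w (Sum.inl
        (j + receivedIdx (fun j => w (Sum.inl j)) (fun j => w (Sum.inr j)) k)))
      (fun j => w (Sum.inr (j + k))) := by
  induction k with
  | zero => ext i; cases i <;> simp [receivedIdx]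
  | succ k ih =>
    rw [Function.iterate_succ_apply', ih]
    ext i
    cases i with
    | inl j =>
      simp [afterReception, dropData, firstIdx, receivedIdx, add_assoc]
    | inr j => simp [afterReception, dropData, add_left_comm, add_comm]

lemma receptions_eq (τ R : ℕ → ℝ) (k : ℕ) :
    receptions (Sum.elim τ R) k =
      inputTime τ (receivedIdx τ R (k + 1)) - inputTime τ (receivedIdx τ R k) := by
  rw [receptions, iterate_afterReception]
  simp only [firstReception, inputs, firstIdx, Sum.elim_inl, Sum.elim_inr, zero_add]
  rw [inputTime_shift]
  rfl

lemma IsLastPath.interreceptionTime_eq {τ : ℕ → ℝ} {x : ℝ → Bool} (hx : IsLastPath τ x)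
    (hτ : ∀ k, 0 < τ k) (hT : Tendsto (inputTime τ) atTop atTop)
    (hoff : ∀ k, 0 < offDuration x k) :
    interreceptionTime x = receptions (Sum.elim τ (offDuration x)) := by
  ext k
  rw [receptions_eq, interreceptionTime, (hx.receptionTime_eq hτ hT hoff k).1,
    (hx.receptionTime_eq hτ hT hoff (k + 1)).1]

/-! ### The interreception times as an i.i.d. sequence -/

section Thin

variable {ν κ : Measure ℝ} [IsProbabilityMeasure ν] [IsProbabilityMeasure κ]

instance isProbabilityMeasure_thin : IsProbabilityMeasure (thin κ ν) :=
  Measure.isProbabilityMeasure_map measurable_firstReception.aemeasurable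

lemma map_receptions (hν : ν (Set.Iic 0) = 0) (hκ : κ (Set.Iic 0) = 0) :
    (drivingLaw ν κ).map receptions = Measure.infinitePi fun _ => thin κ ν :=
  map_orbit_eq_infinitePi measurable_firstReception measurable_afterReception
    (map_firstReception_afterReception hν hκ)

lemma thin_Iic (hν : ν (Set.Iic 0) = 0) (hκ : κ (Set.Iic 0) = 0) :
    thin κ ν (Set.Iic 0) = 0 := by
  rw [thin, Measure.map_apply measurable_firstReception measurableSet_Iic]
  refine measure_mono_null (t := {w | ¬ _}) (fun w hw => ?_) (ae_iff.1 (ae_drivingLaw hν hκ))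
  rintro ⟨-, h2, h3⟩
  have := (mem_passEvent_firstIdx (h2.eventually_gt_atTop (w (Sum.inr 0))).exists).1
  exact absurd (show firstReception w ≤ 0 from hw) (not_le.2 ((h3 0).trans this))

end Thin

/-! ### The transform of the interreception time law -/

lemma expMeasure_Iic_zero {r : ℝ} (hr : 0 < r) : expMeasure r (Set.Iic 0) = 0 := by
  have := isProbabilityMeasure_expMeasure hr
  rw [← ofReal_cdf, cdf_expMeasure_eq hr]
  simp

lemma expMeasure_real_Ico {r a b : ℝ} (hr : 0 < r) (ha : 0 ≤ a) (hab : a ≤ b) :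
    (expMeasure r).real (Set.Ico a b) = Real.exp (-(r * a)) - Real.exp (-(r * b)) := by
  have := isProbabilityMeasure_expMeasure hr
  have : NullSingletonClass (expMeasure r) := ⟨fun x =>
    withDensity_absolutelyContinuous (μ := volume) _ (Real.volume_singleton (a := x))⟩
  rw [measureReal_congr Ico_ae_eq_Ioc, ← Set.Iic_sdiff_Iic,
    measureReal_sdiff (Set.Iic_subset_Iic.2 hab) measurableSet_Iic, ← cdf_eq_real, ← cdf_eq_real,
    cdf_expMeasure_eq hr, cdf_expMeasure_eq hr, if_pos ha, if_pos (ha.trans hab)]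
  ring

lemma ae_pos_of_Iic {ν : Measure ℝ} (hν : ν (Set.Iic 0) = 0) : ∀ᵐ x ∂ν, 0 < x := by
  rw [ae_iff]; simpa [Set.Iic] using hν

section Transform

variable {ν : Measure ℝ} [IsProbabilityMeasure ν]

/-- The function `1 - exp (t x)` is strictly positive for `x > 0`, so its integral is too. This
makes the geometric series below converge. -/
lemma mgf_lt_one (hν : ν (Set.Iic 0) = 0) {t : ℝ} (ht : t < 0) : mgf id ν t < 1 := by
  have hpos := ae_pos_of_Iic hν
  have hint : Integrable (fun x => Real.exp (t * x)) ν := by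
    refine Integrable.of_bound (by fun_prop) 1 ?_
    filter_upwards [hpos] with x hx
    rw [Real.norm_of_nonneg (Real.exp_nonneg _), Real.exp_le_one_iff]
    nlinarith
  have h : 0 < ∫ x, (1 - Real.exp (t * x)) ∂ν := by
    refine (integral_pos_iff_support_of_nonneg_ae ?_ ((integrable_const 1).sub hint)).2 ?_
    rotate_left
    · refine lt_of_lt_of_le ?_ (measure_mono (s := Set.Ioi 0) fun x (hx : 0 < x) => ?_)
      · have : ν (Set.Ioi 0) = 1 := by
          rw [← Set.compl_Iic, prob_compl_eq_one_iff measurableSet_Iic]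
          exact hν
        simp [this]
      · have : Real.exp (t * x) < 1 := by rw [Real.exp_lt_one_iff]; nlinarith
        exact (sub_pos.2 this).ne'
    · filter_upwards [hpos] with x hx
      have : Real.exp (t * x) ≤ 1 := by rw [Real.exp_le_one_iff]; nlinarith
      simpa using this
  rw [integral_sub (integrable_const 1) hint] at h
  simp only [integral_const, probReal_univ, smul_eq_mul, mul_one, sub_pos] at h
  exact h

lemma norm_complexMGF_lt_one (hν : ν (Set.Iic 0) = 0) {z : ℂ} (hz : z.re < 0) :
    ‖complexMGF id ν z‖ < 1 :=
  norm_complexMGF_le_mgf.trans_lt (mgf_lt_one hν hz)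

lemma integral_cexp_inputTime (a b : ℂ) (m : ℕ) :
    ∫ w, Complex.exp (a * inputTime w m) * Complex.exp (b * w m)
      ∂(Measure.infinitePi fun _ : ℕ => ν) =
      complexMGF id ν a ^ m * complexMGF id ν b := by
  have hind : iIndepFun (fun (i : Fin (m + 1)) (w : ℕ → ℝ) => w i)
      (Measure.infinitePi fun _ : ℕ => ν) :=
    (iIndepFun_infinitePi (P := fun _ : ℕ => ν) (X := fun _ x => x)
      fun _ => measurable_id).precomp Fin.val_injective
  -- `inputTime w m` involves the coordinates below `m` only; of the `m + 1` independent factors the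
  -- last carries `b`, the others `a`.
  have hprod := hind.integral_fun_prod_comp
    (f := fun i (x : ℝ) => Complex.exp ((if i = Fin.last m then b else a) * x))
    (fun i => (measurable_pi_apply _).aemeasurable) fun i => by fun_prop
  have hmgf : ∀ (c : ℂ) (i : ℕ), ∫ w : ℕ → ℝ, Complex.exp (c * w i)
      ∂(Measure.infinitePi fun _ : ℕ => ν) = complexMGF id ν c := by
    intro c i
    rw [complexMGF]
    conv_rhs => rw [← Measure.infinitePi_map_eval (fun _ : ℕ => ν) i]
    rw [integral_map (measurable_pi_apply i).aemeasurable (by fun_prop)]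
    rfl
  simp only [hmgf] at hprod
  simp only [Fin.prod_univ_castSucc, Fin.castSucc_ne_last, if_false, if_true, Fin.val_castSucc,
    Fin.val_last, Finset.prod_const, Finset.card_univ, Fintype.card_fin] at hprod
  rw [← hprod]
  congr 1
  ext1 w
  congr 1
  rw [inputTime, Finset.sum_range, ← Complex.exp_sum]
  push_cast
  rw [Finset.mul_sum]

lemma map_drivingLaw_prod (κ : Measure ℝ) [IsProbabilityMeasure κ] :
    (drivingLaw ν κ).map (fun w => (fun j => w (Sum.inl j), w (Sum.inr 0))) =
      (Measure.infinitePi fun _ : ℕ => ν).prod κ := by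
  have h := map_infinitePi_sumElim (fun _ : ℕ => ν) (fun _ : ℕ => κ)
  rw [← Measure.infinitePi_map_eval (fun _ : ℕ => κ) 0]
  conv_rhs => rw [← Measure.map_id (μ := Measure.infinitePi fun _ : ℕ => ν)]
  rw [Measure.map_prod_map _ _ measurable_id (measurable_pi_apply 0), Measure.infinitePi_map_eval,
    ← h, Measure.map_map (by fun_prop) (by fun_prop)]
  rfl

lemma norm_cexp_le_one {z : ℂ} {x : ℝ} (hz : z.re ≤ 0) (hx : 0 ≤ x) :
    ‖Complex.exp (z * x)‖ ≤ 1 := by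
  rw [Complex.norm_exp, Real.exp_le_one_iff, Complex.re_mul_ofReal]
  exact mul_nonpos_of_nonpos_of_nonneg hz hx

lemma inputTime_nonneg {τ : ℕ → ℝ} (hτ : ∀ k, 0 < τ k) (m : ℕ) : 0 ≤ inputTime τ m :=
  Finset.sum_nonneg fun k _ => (hτ k).le

lemma measurable_inputTime (m : ℕ) : Measurable fun τ : ℕ → ℝ => inputTime τ m := by
  unfold inputTime; fun_prop

/-- Integrating out the off-duration first leaves `exp (z T_{m+1}) (exp (-r T_m) - exp (-r
T_{m+1}))`. With `T_{m+1} = T_m + τ_m` both terms factor by independence. -/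
lemma setIntegral_passEvent_succ (hν : ν (Set.Iic 0) = 0) {r : ℝ} (hr : 0 < r) {z : ℂ}
    (hz : z.re ≤ 0) (m : ℕ) :
    ∫ w in passEvent (m + 1), Complex.exp (z * firstReception w) ∂drivingLaw ν (expMeasure r) =
      complexMGF id ν (z - r) ^ m * (complexMGF id ν z - complexMGF id ν (z - r)) := by
  have := isProbabilityMeasure_expMeasure hr
  set M := Measure.infinitePi fun _ : ℕ => ν with hM
  have hpos : ∀ᵐ τ ∂M, ∀ k, 0 < τ k := (ae_tendsto_inputTime ν hν).mono fun _ h => h.1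
  let G : (ℕ → ℝ) × ℝ → ℂ := fun p =>
    (Set.Ico (inputTime p.1 m) (inputTime p.1 (m + 1))).indicator
      (fun _ => Complex.exp (z * inputTime p.1 (m + 1))) p.2
  have hGm : Measurable G := by
    have hs : MeasurableSet {p : (ℕ → ℝ) × ℝ |
        p.2 ∈ Set.Ico (inputTime p.1 m) (inputTime p.1 (m + 1))} :=
      (measurableSet_le ((measurable_inputTime m).comp measurable_fst) measurable_snd).inter
        (measurableSet_lt measurable_snd ((measurable_inputTime _).comp measurable_fst))
    have hf : Measurable fun p : (ℕ → ℝ) × ℝ => Complex.exp (z * inputTime p.1 (m + 1)) := by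
      have : Measurable fun p : (ℕ → ℝ) × ℝ => inputTime p.1 (m + 1) :=
        (measurable_inputTime (m + 1)).comp measurable_fst
      fun_prop
    exact hf.indicator hs
  have hGint : Integrable G (M.prod (expMeasure r)) := by
    refine Integrable.of_bound hGm.aestronglyMeasurable 1 ?_
    have := Measure.quasiMeasurePreserving_fst (μ := M) (ν := expMeasure r) |>.ae hpos
    filter_upwards [this] with p hp
    refine (norm_indicator_le_norm_self _ _).trans (norm_cexp_le_one hz (inputTime_nonneg hp _))
  have hstep1 : ∫ w in passEvent (m + 1), Complex.exp (z * firstReception w)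
      ∂drivingLaw ν (expMeasure r) = ∫ p, G p ∂(M.prod (expMeasure r)) := by
    rw [← map_drivingLaw_prod, integral_map (Measurable.aemeasurable (by fun_prop))
      hGm.aestronglyMeasurable, ← integral_indicator (measurableSet_passEvent _)]
    refine integral_congr_ae ?_
    filter_upwards [ae_drivingLaw hν (expMeasure_Iic_zero hr)] with w hw
    have hiff : w ∈ passEvent (m + 1) ↔ w (Sum.inr 0) ∈ Set.Ico
        (inputTime (fun j => w (Sum.inl j)) m) (inputTime (fun j => w (Sum.inl j)) (m + 1)) := by
      refine ⟨fun h => ⟨h.2 m (Nat.lt_succ_self m), h.1⟩, fun h => ⟨h.2, fun j hj => ?_⟩⟩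
      exact ((strictMono_inputTime hw.1).monotone (Nat.lt_succ_iff.1 hj)).trans h.1
    by_cases hmem : w ∈ passEvent (m + 1)
    · simp only [G]
      rw [Set.indicator_of_mem hmem, Set.indicator_of_mem (hiff.1 hmem), firstReception,
        firstIdx_of_mem_passEvent hmem]
      rfl
    · simp only [G]
      rw [Set.indicator_of_notMem hmem, Set.indicator_of_notMem (hiff.not.1 hmem)]
  have hexp : ∀ (a : ℂ), a.re ≤ 0 → ∀ b : ℂ, b.re ≤ 0 → Integrable
      (fun τ => Complex.exp (a * inputTime τ m) * Complex.exp (b * τ m)) M := by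
    intro a ha b hb
    refine Integrable.of_bound (Measurable.aestronglyMeasurable ?_) 1 ?_
    · have := measurable_inputTime m
      fun_prop
    · filter_upwards [hpos] with τ hτ
      rw [norm_mul]
      exact mul_le_one₀ (norm_cexp_le_one ha (inputTime_nonneg hτ _)) (norm_nonneg _)
        (norm_cexp_le_one hb (hτ m).le)
  have hzr : (z - r).re ≤ 0 := by simp only [Complex.sub_re, Complex.ofReal_re]; linarith
  have hstep2 : ∫ p, G p ∂(M.prod (expMeasure r)) =
      ∫ τ, (Complex.exp ((z - r) * inputTime τ m) * Complex.exp (z * τ m) -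
        Complex.exp ((z - r) * inputTime τ m) * Complex.exp ((z - r) * τ m)) ∂M := by
    rw [integral_prod _ hGint]
    refine integral_congr_ae ?_
    filter_upwards [hpos] with τ hτ
    simp only [G]
    rw [integral_indicator measurableSet_Ico, setIntegral_const,
      expMeasure_real_Ico hr (inputTime_nonneg hτ _)
        ((strictMono_inputTime hτ).monotone (Nat.le_succ m)), Complex.real_smul]
    have hsucc : inputTime τ (m + 1) = inputTime τ m + τ m := by
      simp [inputTime, Finset.sum_range_succ]
    rw [hsucc]
    push_cast
    rw [sub_mul, ← Complex.exp_add, ← Complex.exp_add, ← Complex.exp_add, ← Complex.exp_add]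
    congr 2 <;> ring
  rw [hstep1, hstep2, integral_sub (hexp _ hzr _ hz) (hexp _ hzr _ hzr), integral_cexp_inputTime,
    integral_cexp_inputTime]
  ring

lemma complexMGF_thin (hν : ν (Set.Iic 0) = 0) {r : ℝ} (hr : 0 < r) {z : ℂ} (hz : z.re ≤ 0) :
    complexMGF id (thin (expMeasure r) ν) z =
      (1 - complexMGF id ν (z - r))⁻¹ * (complexMGF id ν z - complexMGF id ν (z - r)) := by
  have := isProbabilityMeasure_expMeasure hr
  have hκ := expMeasure_Iic_zero hr
  rw [thin, complexMGF_id_map measurable_firstReception.aemeasurable]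
  have hcov := ae_mem_passEvent hν hκ
  have hint : Integrable (fun w => Complex.exp (z * firstReception w))
      (drivingLaw ν (expMeasure r)) := by
    refine Integrable.of_bound (Measurable.aestronglyMeasurable ?_) 1 ?_
    · have := measurable_firstReception
      fun_prop
    · filter_upwards [ae_drivingLaw hν hκ] with w hw
      exact norm_cexp_le_one hz (inputTime_nonneg hw.1 _)
  have hsum := hasSum_integral_iUnion measurableSet_passEvent pairwise_disjoint_passEvent
    hint.integrableOn
  have hfull : ∫ w in ⋃ m, passEvent m, Complex.exp (z * firstReception w)
      ∂drivingLaw ν (expMeasure r) = complexMGF firstReception (drivingLaw ν (expMeasure r)) z := by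
    rw [complexMGF, setIntegral_eq_integral_of_ae_compl_eq_zero]
    filter_upwards [hcov] with w hw hw'
    exact absurd (Set.mem_iUnion.2 hw) hw'
  have hzero : ∫ w in passEvent 0, Complex.exp (z * firstReception w)
      ∂drivingLaw ν (expMeasure r) = 0 := by
    -- `T_0 = 0` cannot exceed a positive off-duration, so the series effectively starts at index 1.
    refine setIntegral_measure_zero _ (measure_mono_null (t := {w | ¬ _}) (fun w hw => ?_)
      (ae_iff.1 (ae_drivingLaw hν hκ)))
    rintro ⟨-, -, h3⟩
    have h0 : inputs 0 w = 0 := by simp [inputs, inputTime]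
    have := hw.1
    rw [h0] at this
    exact absurd (h3 0) (not_lt.2 this.le)
  rw [hfull, ← hasSum_nat_add_iff' 1] at hsum
  simp only [Finset.range_one, Finset.sum_singleton, hzero, sub_zero,
    setIntegral_passEvent_succ hν hr hz] at hsum
  have hzr : (z - r).re < 0 := by simp only [Complex.sub_re, Complex.ofReal_re]; linarith
  exact hsum.unique ((hasSum_geometric_of_norm_lt_one (norm_complexMGF_lt_one hν hzr)).mul_right _)

lemma one_sub_complexMGF_thin (hν : ν (Set.Iic 0) = 0) {r : ℝ} (hr : 0 < r) {z : ℂ}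
    (hz : z.re ≤ 0) :
    1 - complexMGF id (thin (expMeasure r) ν) z =
      (1 - complexMGF id ν z) / (1 - complexMGF id ν (z - r)) := by
  have hzr : (z - r).re < 0 := by simp only [Complex.sub_re, Complex.ofReal_re]; linarith
  have hne : 1 - complexMGF id ν (z - r) ≠ 0 := sub_ne_zero.2 fun h => by
    have := norm_complexMGF_lt_one hν hzr
    rw [← h] at this
    simp at this
  rw [complexMGF_thin hν hr hz]
  field_simp
  ring

/-- Equality is needed only on the imaginary axis, where the transform is the characteristic
function; the shifted points `z - a`, `z - b`, `z - a - b` stay in the left half-plane. -/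
lemma thin_comm (hν : ν (Set.Iic 0) = 0) {a b : ℝ} (ha : 0 < a) (hb : 0 < b) :
    thin (expMeasure a) (thin (expMeasure b) ν) = thin (expMeasure b) (thin (expMeasure a) ν) := by
  have := isProbabilityMeasure_expMeasure ha
  have := isProbabilityMeasure_expMeasure hb
  have h2 : ∀ {a b : ℝ}, 0 < a → 0 < b → ∀ z : ℂ, z.re ≤ 0 →
      1 - complexMGF id (thin (expMeasure a) (thin (expMeasure b) ν)) z =
        (1 - complexMGF id ν z) / (1 - complexMGF id ν (z - b)) /
          ((1 - complexMGF id ν (z - a)) / (1 - complexMGF id ν (z - a - b))) := by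
    intro a b ha hb z hz
    have := isProbabilityMeasure_expMeasure hb
    rw [one_sub_complexMGF_thin (thin_Iic hν (expMeasure_Iic_zero hb)) ha hz,
      one_sub_complexMGF_thin hν hb hz, one_sub_complexMGF_thin hν hb]
    simp only [Complex.sub_re, Complex.ofReal_re]
    linarith
  refine Measure.ext_of_charFun (funext fun t => ?_)
  rw [← complexMGF_id_mul_I, ← complexMGF_id_mul_I]
  have hz : ((t : ℂ) * Complex.I).re ≤ 0 := by simp
  refine sub_right_injective (b := (1 : ℂ)) ?_
  simp only
  rw [h2 ha hb _ hz, h2 hb ha _ hz, sub_right_comm _ (b : ℂ), div_div_div_eq, div_div_div_eq,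
    mul_comm (1 - complexMGF id ν (t * Complex.I - b))]

end Transform

/-! ### Peeling off the rightmost node -/

/-- The interreception times are functions of one block of the data and thus stay independent of the
other block, here the off-durations of the remaining nodes. -/
lemma hasLaw_sumElim_receptions {α Ω : Type*} [MeasurableSpace Ω] {P : Measure Ω}
    {ν κ : Measure ℝ} [IsProbabilityMeasure ν] [IsProbabilityMeasure κ]
    (hν : ν (Set.Iic 0) = 0) (hκ : κ (Set.Iic 0) = 0)
    {μ : α → Measure ℝ} [∀ i, IsProbabilityMeasure (μ i)] {W : Ω → (ℕ ⊕ ℕ) ⊕ α → ℝ}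
    (hW : HasLaw W (Measure.infinitePi
      (Sum.elim (Sum.elim (fun _ => ν) (fun _ => κ)) μ)) P) :
    HasLaw (fun ω => (Sum.elim (receptions fun i => W ω (Sum.inl i)) (fun i => W ω (Sum.inr i)) :
      ℕ ⊕ α → ℝ)) (Measure.infinitePi (Sum.elim (fun _ => thin κ ν) μ)) P := by
  have h1 : HasLaw (fun w : (ℕ ⊕ ℕ) ⊕ α → ℝ => (fun i => w (Sum.inl i), fun i => w (Sum.inr i)))
      ((drivingLaw ν κ).prod (Measure.infinitePi μ)) (Measure.infinitePi
        (Sum.elim (Sum.elim (fun _ => ν) (fun _ => κ)) μ)) :=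
    ⟨Measurable.aemeasurable (by fun_prop), map_infinitePi_sumElim _ μ⟩
  have h2 : HasLaw (Prod.map receptions id)
      ((Measure.infinitePi fun _ : ℕ => thin κ ν).prod (Measure.infinitePi μ))
      ((drivingLaw ν κ).prod (Measure.infinitePi μ)) := by
    refine ⟨(measurable_receptions.prodMap measurable_id).aemeasurable, ?_⟩
    rw [← Measure.map_prod_map _ _ measurable_receptions measurable_id, map_receptions hν hκ,
      Measure.map_id]
  have h3 : HasLaw (fun p : (ℕ → ℝ) × (α → ℝ) => (Sum.elim p.1 p.2 : ℕ ⊕ α → ℝ))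
      (Measure.infinitePi (Sum.elim (fun _ => thin κ ν) μ))
      ((Measure.infinitePi fun _ : ℕ => thin κ ν).prod (Measure.infinitePi μ)) :=
    ⟨measurable_sumElim.aemeasurable, map_sumElim_prod_infinitePi _ μ⟩
  exact h3.comp (h2.comp (h1.comp hW))

namespace IsOnOffSystem

variable {n : ℕ} {Ω : Type*} [MeasurableSpace Ω] {P : Measure Ω} {ν : Measure ℝ}
  {τ : ℕ → Ω → ℝ}

lemma hasLaw_data {ρ : Fin n → ℝ} {X : Fin n → ℝ → Ω → Bool} (hX : IsOnOffSystem P ν ρ τ X) :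
    HasLaw (fun ω i => Sum.elim τ
      (fun (p : Fin n × ℕ) (ω : Ω) => offDuration (fun t => X p.1 t ω) p.2) i ω)
      (Measure.infinitePi (Sum.elim (fun _ => ν) (fun p => expMeasure (ρ p.1)))) P := by
  have hlaw : ∀ i, HasLaw (Sum.elim τ
      (fun (p : Fin n × ℕ) (ω : Ω) => offDuration (fun t => X p.1 t ω) p.2) i)
      (Sum.elim (fun _ => ν) (fun p => expMeasure (ρ p.1)) i) P := by
    rintro (k | p)
    · exact hX.law_input k
    · exact hX.law_off p.1 p.2
  exact hX.indep.hasLaw_infinitePi hlaw (aemeasurable_pi_iff.2 fun i => (hlaw i).aemeasurable)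

variable [IsProbabilityMeasure ν]

lemma of_hasLaw_data [IsProbabilityMeasure P] {ρ : Fin n → ℝ}
    {X : Fin n → ℝ → Ω → Bool} (hρ : ∀ j, 0 < ρ j)
    (h : HasLaw (fun ω i => Sum.elim τ
      (fun (p : Fin n × ℕ) (ω : Ω) => offDuration (fun t => X p.1 t ω) p.2) i ω)
      (Measure.infinitePi (Sum.elim (fun _ => ν) (fun p => expMeasure (ρ p.1)))) P)
    (hpath : ∀ᵐ ω ∂P, IsOnOffPath (fun k => τ k ω) (fun i t => X i t ω)) :
    IsOnOffSystem P ν ρ τ X := by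
  have := fun j => isProbabilityMeasure_expMeasure (hρ j)
  have hlaw : ∀ i, HasLaw (Sum.elim τ
      (fun (p : Fin n × ℕ) (ω : Ω) => offDuration (fun t => X p.1 t ω) p.2) i)
      (Sum.elim (fun _ => ν) (fun p => expMeasure (ρ p.1)) i) P := fun i =>
    (measurePreserving_eval_infinitePi _ i).hasLaw.comp h
  exact ⟨fun k => hlaw (Sum.inl k), fun i k => hlaw (Sum.inr (i, k)),
    (iIndepFun_iff_hasLaw_Pi_infinitePi hlaw h.aemeasurable).2 h, hpath⟩

variable {ρ : Fin (n + 1) → ℝ} {X : Fin (n + 1) → ℝ → Ω → Bool}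

lemma ae_last (hX : IsOnOffSystem P ν ρ τ X) (hν : ν (Set.Iic 0) = 0) (hρ : ∀ j, 0 < ρ j) :
    ∀ᵐ ω ∂P, IsOnOffPath (fun k => τ k ω) (fun i t => X i t ω) ∧ (∀ k, 0 < τ k ω) ∧
      Tendsto (inputTime fun k => τ k ω) atTop atTop ∧
      ∀ k, 0 < offDuration (fun t => X (Fin.last n) t ω) k := by
  have := fun j => isProbabilityMeasure_expMeasure (hρ j)
  have hproj : HasLaw (fun (w : ℕ ⊕ (Fin (n + 1) × ℕ) → ℝ) k => w (Sum.inl k))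
      (Measure.infinitePi fun _ : ℕ => ν)
      (Measure.infinitePi (Sum.elim (fun _ => ν) (fun p => expMeasure (ρ p.1)))) :=
    ⟨Measurable.aemeasurable (by fun_prop),
      Measure.map_infinitePi_infinitePi_of_inj Sum.inl_injective⟩
  have hτ : HasLaw (fun ω k => τ k ω) (Measure.infinitePi fun _ : ℕ => ν) P :=
    hproj.comp hX.hasLaw_data
  have a1 := ae_tendsto_inputTime ν hν
  rw [← hτ.map_eq] at a1
  have a2 : ∀ k, ∀ᵐ ω ∂P, 0 < offDuration (fun t => X (Fin.last n) t ω) k := fun k => by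
    have := ae_pos_of_Iic (expMeasure_Iic_zero (hρ (Fin.last n)))
    rw [← (hX.law_off (Fin.last n) k).map_eq] at this
    exact ae_of_ae_map (hX.law_off (Fin.last n) k).aemeasurable this
  filter_upwards [hX.path, ae_of_ae_map hτ.aemeasurable a1, ae_all_iff.2 a2] with ω h1 h2 h3
  exact ⟨h1, h2.1, h2.2, h3⟩

lemma hasLaw_reduced (hX : IsOnOffSystem P ν ρ τ X) (hν : ν (Set.Iic 0) = 0)
    (hρ : ∀ j, 0 < ρ j) :
    HasLaw (fun ω i => Sum.elim
      (fun k (ω : Ω) => interreceptionTime (fun t => X (Fin.last n) t ω) k)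
      (fun (p : Fin n × ℕ) (ω : Ω) => offDuration (fun t => X p.1.castSucc t ω) p.2) i ω)
      (Measure.infinitePi (Sum.elim (fun _ => thin (expMeasure (ρ (Fin.last n))) ν)
        (fun p => expMeasure (ρ p.1.castSucc)))) P := by
  have := fun j => isProbabilityMeasure_expMeasure (hρ j)
  -- Regroups the data: inputs with the off-durations of the last node, against all other
  -- off-durations.
  let f : (ℕ ⊕ ℕ) ⊕ (Fin n × ℕ) → ℕ ⊕ (Fin (n + 1) × ℕ) :=
    Sum.elim (Sum.map id fun k => (Fin.last n, k)) fun p => Sum.inr (p.1.castSucc, p.2)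
  have hf : Function.Injective f := by
    rintro ((a | a) | ⟨a, a'⟩) ((b | b) | ⟨b, b'⟩) h <;>
      simp_all [f, Fin.castSucc_ne_last, (Fin.castSucc_ne_last _).symm]
  have hre : HasLaw (fun (w : ℕ ⊕ (Fin (n + 1) × ℕ) → ℝ) i => w (f i))
      (Measure.infinitePi (Sum.elim (Sum.elim (fun _ => ν)
        (fun _ => expMeasure (ρ (Fin.last n)))) (fun p => expMeasure (ρ p.1.castSucc))))
      (Measure.infinitePi (Sum.elim (fun _ => ν) (fun p => expMeasure (ρ p.1)))) := by
    refine ⟨Measurable.aemeasurable (by fun_prop), ?_⟩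
    rw [Measure.map_infinitePi_infinitePi_of_inj hf]
    congr 1
    ext1 i
    rcases i with (i | i) | i <;> rfl
  refine (hasLaw_sumElim_receptions hν (expMeasure_Iic_zero (hρ _))
    (hre.comp hX.hasLaw_data)).congr ?_
  filter_upwards [hX.ae_last hν hρ] with ω ⟨h1, h2, h3, h4⟩
  ext i
  rcases i with k | p
  · change interreceptionTime (fun t => X (Fin.last n) t ω) k = _
    rw [h1.isLastPath.interreceptionTime_eq h2 h3 h4]
    change _ = receptions _ k
    congr 1
    ext1 i
    cases i <;> rfl
  · rfl

/-- The nodes to the left of the rightmost one form an on-off system whose input intervals are the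
interreception times of the rightmost node. -/
lemma castSucc [IsProbabilityMeasure P] (hX : IsOnOffSystem P ν ρ τ X)
    (hν : ν (Set.Iic 0) = 0) (hρ : ∀ j, 0 < ρ j) :
    IsOnOffSystem P (thin (expMeasure (ρ (Fin.last n))) ν) (fun i => ρ i.castSucc)
      (fun k ω => interreceptionTime (fun t => X (Fin.last n) t ω) k)
      (fun i => X i.castSucc) := by
  have := isProbabilityMeasure_expMeasure (hρ (Fin.last n))
  refine of_hasLaw_data (fun j => hρ _) (hX.hasLaw_reduced hν hρ) ?_
  filter_upwards [hX.ae_last hν hρ] with ω ⟨h1, h2, h3, h4⟩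
  exact h1.castSucc h2 h3 h4

end IsOnOffSystem

/-- The interreception time law of the leftmost of several nodes with recovery rates `l` and
input interval law `ν`. -/
def interreceptionLaw (ν : Measure ℝ) (l : List ℝ) : Measure ℝ :=
  l.foldr (fun r μ => thin (expMeasure r) μ) ν

lemma IsOnOffSystem.interreception {n : ℕ} {Ω : Type*} [MeasurableSpace Ω] {P : Measure Ω}
    [IsProbabilityMeasure P] {ν : Measure ℝ} [IsProbabilityMeasure ν] (hν : ν (Set.Iic 0) = 0)
    {ρ : Fin n → ℝ} (hρ : ∀ j, 0 < ρ j) {τ : ℕ → Ω → ℝ} {X : Fin n → ℝ → Ω → Bool}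
    (hX : IsOnOffSystem P ν ρ τ X) (i : Fin n) :
    (∀ᵐ ω ∂P, ∀ k, IsLeast
      {t | receptionTime (fun t => X i t ω) k < t ∧ Receives (fun t => X i t ω) t}
      (receptionTime (fun t => X i t ω) (k + 1))) ∧
    ∀ k, HasLaw (fun ω => interreceptionTime (fun t => X i t ω) k)
      (interreceptionLaw ν ((List.ofFn ρ).drop i)) P := by
  induction n generalizing ν τ with
  | zero => exact i.elim0
  | succ n ih =>
    have := isProbabilityMeasure_expMeasure (hρ (Fin.last n))
    have hred := hX.castSucc hν hρ
    -- With the last rate at the end of the list, `foldr` applies its thinning first, which matches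
    -- replacing `ν` by the thinned law in the induction.
    rw [List.ofFn_succ', List.concat_eq_append]
    induction i using Fin.lastCases with
    | last =>
      refine ⟨?_, fun k => ?_⟩
      · filter_upwards [hX.ae_last hν hρ] with ω ⟨h1, h2, h3, h4⟩
        exact h1.isLastPath.isLeast h2 h3 h4
      · simpa [interreceptionLaw] using hred.law_input k
    | cast i =>
      have h := ih (thin_Iic hν (expMeasure_Iic_zero (hρ _))) (fun j => hρ _) hred i
      rw [List.drop_append_of_le_length (by simp [i.is_lt.le])]
      simpa [interreceptionLaw] using h

/-! ### Invariance under permutations of the rates -/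

lemma interreceptionLaw_spec {ν : Measure ℝ} [IsProbabilityMeasure ν] (hν : ν (Set.Iic 0) = 0)
    {l : List ℝ} (hl : ∀ r ∈ l, 0 < r) :
    IsProbabilityMeasure (interreceptionLaw ν l) ∧ interreceptionLaw ν l (Set.Iic 0) = 0 := by
  induction l with
  | nil => exact ⟨‹_›, hν⟩
  | cons r l ih =>
    obtain ⟨h1, h2⟩ := ih fun s hs => hl s (List.mem_cons_of_mem _ hs)
    have hr := hl r List.mem_cons_self
    have := isProbabilityMeasure_expMeasure hr
    have hprob : IsProbabilityMeasure (thin (expMeasure r) (interreceptionLaw ν l)) :=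
      inferInstance
    have hnull : thin (expMeasure r) (interreceptionLaw ν l) (Set.Iic 0) = 0 :=
      thin_Iic h2 (expMeasure_Iic_zero hr)
    exact ⟨hprob, hnull⟩

/-- For a swap at the head, the tail law serves as the input law in `thin_comm`, which is why it
must again be a probability law on the positive reals. -/
lemma interreceptionLaw_perm {ν : Measure ℝ} [IsProbabilityMeasure ν] (hν : ν (Set.Iic 0) = 0)
    {l l' : List ℝ} (h : l.Perm l') (hl : ∀ r ∈ l, 0 < r) :
    interreceptionLaw ν l = interreceptionLaw ν l' := by
  induction h with
  | nil => rfl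
  | cons r _ ih =>
    exact congrArg (thin (expMeasure r)) (ih fun s hs => hl s (List.mem_cons_of_mem _ hs))
  | swap a b l =>
    obtain ⟨h1, h2⟩ := interreceptionLaw_spec hν (l := l) fun s hs =>
      hl s (List.mem_cons_of_mem _ (List.mem_cons_of_mem _ hs))
    exact thin_comm h2 (hl b (by simp)) (hl a (by simp))
  | trans h1 _ ih1 ih2 =>
    exact (ih1 hl).trans (ih2 fun r hr => hl r (h1.mem_iff.2 hr))

/-- The full lists are permutations of each other and have the same first `i` entries, so this
common prefix cancels. -/
lemma drop_ofFn_perm {n : ℕ} (ρ : Fin n → ℝ) (i : Fin n) (σ : Equiv.Perm (Fin n))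
    (hσ : ∀ j, j < i → σ j = j) :
    ((List.ofFn ρ).drop i).Perm ((List.ofFn fun j => ρ (σ j)).drop i) := by
  have htake : (List.ofFn ρ).take i = (List.ofFn fun j => ρ (σ j)).take i := by
    refine List.ext_getElem (by simp) fun k h1 h2 => ?_
    have hk : k < i := by simp at h1; omega
    have := hσ ⟨k, hk.trans i.is_lt⟩ hk
    simp [this]
  have hperm : (List.ofFn ρ).Perm (List.ofFn fun j => ρ (σ j)) :=
    (Equiv.Perm.ofFn_comp_perm σ ρ).symm
  rw [← List.take_append_drop i (List.ofFn ρ),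
    ← List.take_append_drop i (List.ofFn fun j => ρ (σ j)), htake] at hperm
  exact (List.perm_append_left_iff _).1 hperm

end OnOff

end

/-- The interreception time distribution of node `i` does not change under a permutation `σ` of the
recovery rates of the nodes `i, …, n`. The first conjunct says that the successive reception times
of node `i` are almost surely well defined; the second one (in which `σ` may be the identity) says
in particular that all interreception times of node `i` in one system have the same law. -/
theorem lemma3 {n : ℕ} (ν : MeasureTheory.Measure ℝ) [MeasureTheory.IsProbabilityMeasure ν]
    (hν : ν (Set.Iic 0) = 0) (ρ : Fin n → ℝ) (hρ : ∀ j, 0 < ρ j)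
    (i : Fin n) (σ : Equiv.Perm (Fin n)) (hσ : ∀ j, j < i → σ j = j)
    {Ω : Type*} [MeasurableSpace Ω] (P : MeasureTheory.Measure Ω)
    [MeasureTheory.IsProbabilityMeasure P] (τ : ℕ → Ω → ℝ) (X : Fin n → ℝ → Ω → Bool)
    (hX : OnOff.IsOnOffSystem P ν ρ τ X)
    {Ω' : Type*} [MeasurableSpace Ω'] (P' : MeasureTheory.Measure Ω')
    [MeasureTheory.IsProbabilityMeasure P'] (τ' : ℕ → Ω' → ℝ) (X' : Fin n → ℝ → Ω' → Bool)
    (hX' : OnOff.IsOnOffSystem P' ν (fun j => ρ (σ j)) τ' X') :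
    (∀ᵐ ω ∂P, ∀ k, IsLeast
      {t | OnOff.receptionTime (fun t => X i t ω) k < t ∧ OnOff.Receives (fun t => X i t ω) t}
      (OnOff.receptionTime (fun t => X i t ω) (k + 1))) ∧
    ∀ k l, ProbabilityTheory.IdentDistrib
      (fun ω => OnOff.interreceptionTime (fun t => X i t ω) k)
      (fun ω => OnOff.interreceptionTime (fun t => X' i t ω) l) P P' := by
  obtain ⟨h1, h2⟩ := hX.interreception hν hρ i
  obtain ⟨-, h2'⟩ := hX'.interreception hν (fun j => hρ _) i
  refine ⟨h1, fun k l => ⟨(h2 k).aemeasurable, (h2' l).aemeasurable, ?_⟩⟩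
  rw [(h2 k).map_eq, (h2' l).map_eq]
  exact OnOff.interreceptionLaw_perm hν (OnOff.drop_ofFn_perm ρ i σ hσ) fun r hr => by
    obtain ⟨j, rfl⟩ := List.mem_ofFn.1 (List.mem_of_mem_drop hr)
    exact hρ j
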